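/- For a commutative ring $R$, an $R$-module $L$ and $n\ge 0$, let $\mathrm{T}^n_R(L)=L\otimes_R\cdots\otimes_R L$ ($n$ factors), let $\mathrm{TS}^n_R(L)=\mathrm{T}^n_R(L)^{\mathfrak S_n}$ be the submodule of symmetric tensors, let $\Gamma^n_R(L)$ be the degree $n$ part of the divided power algebra of $L$, with its divided powers $\gamma^n(x)$ for $x\in L$, and let $\Gamma^n_R(L)\to\mathrm{TS}^n_R(L)$ be the canonical $R$-linear map, which sends $\gamma^n(x)$ to $x^{\otimes n}$ (for $n=2$ it is the only linear map with this property). Let $k$ be a field of characteristic $2$, let $A=k[s,t]$ be the polynomial ring, let $F=A^2$ with standard basis $e_1,e_2$, and let $M=F/\langle s e_1+t e_2\rangle$. Let $A'=k[s,t,z]/(z(s+t))$, regarded as an $A$-algebra, and put $F'=F\otimes_A A'$ and $M'=M\otimes_A A'$; write $e_1,e_2$ also for the induced basis of $F'$. Then: 1. The canonical map $\Gamma^2_A(M)\to\mathrm{TS}^2_A(M)$ is injective. 2. The canonical map $\Gamma^2_{A'}(M')\to\mathrm{TS}^2_{A'}(M')$ is not injective. 3. More precisely, let $N'$ be the kernel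 of $\mathrm{T}^2_{A'}(F')\to\mathrm{T}^2_{A'}(M')$. The canonical map $\Gamma^2_{A'}(F')\to\mathrm{TS}^2_{A'}(F')$ is bijective; let $K'\subseteq\mathrm{TS}^2_{A'}(F')$ be the kernel of the resulting map $\mathrm{TS}^2_{A'}(F')\cong\Gamma^2_{A'}(F')\to\Gamma^2_{A'}(M')$. Then $K'\subseteq (N')^{\mathfrak S_2}$, and the element $zs(e_1\otimes e_1+e_2\otimes e_2)$ lies in $(N')^{\mathfrak S_2}$ but not in $K'$. -/

import Mathlib

open scoped TensorProduct

noncomputable section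

namespace SymDiv

/-! ### Elementary symmetric sums of square-zero elements -/

section ESum

variable {R ι : Type*} [CommRing R]

/-- The `k`-th elementary symmetric sum of the family `f` over the finite index set `s`. -/
def esum (s : Finset ι) (k : ℕ) (f : ι → R) : R :=
  ∑ S ∈ s.powersetCard k, ∏ i ∈ S, f i

theorem esum_zero (s : Finset ι) (f : ι → R) : esum s 0 f = 1 := by
  simp [esum]

theorem esum_empty_succ (k : ℕ) (f : ι → R) : esum (∅ : Finset ι) (k + 1) f = 0 := by
  unfold esum
  rw [Finset.powersetCard_eq_empty.2 (by simp), Finset.sum_empty]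

theorem esum_insert_succ [DecidableEq ι] {s : Finset ι} {a : ι} (h : a ∉ s) (k : ℕ) (f : ι → R) :
    esum (insert a s) (k + 1) f = esum s (k + 1) f + f a * esum s k f := by
  unfold esum
  rw [← Nat.succ_eq_add_one, Finset.powersetCard_succ_insert h, Finset.sum_union]
  · congr 1
    rw [Finset.sum_image, Finset.mul_sum]
    · refine Finset.sum_congr rfl fun S hS => ?_
      rw [Finset.prod_insert]
      exact fun ha => h ((Finset.mem_powersetCard.1 hS).1 ha)
    · intro S hS T hT hST
      have h1 : a ∉ S := fun ha => h ((Finset.mem_powersetCard.1 hS).1 ha)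
      have h2 : a ∉ T := fun ha => h ((Finset.mem_powersetCard.1 hT).1 ha)
      rw [← Finset.erase_insert h1, ← Finset.erase_insert h2]
      exact congrArg (fun U => Finset.erase U a) hST
  · rw [Finset.disjoint_left]
    intro S hS hS'
    obtain ⟨T, _, rfl⟩ := Finset.mem_image.1 hS'
    exact h ((Finset.mem_powersetCard.1 hS).1 (Finset.mem_insert_self a T))

theorem esum_mul [DecidableEq ι] (s : Finset ι) (f : ι → R) (hf : ∀ i, f i * f i = 0) (k l : ℕ) :
    esum s k f * esum s l f = (k + l).choose k • esum s (k + l) f := by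
  induction s using Finset.induction_on generalizing k l with
  | empty =>
    rcases k with _ | k
    · simp [esum_zero]
    · rw [esum_empty_succ, zero_mul, show k + 1 + l = (k + l) + 1 by ring, esum_empty_succ,
        smul_zero]
  | insert a s ha ih =>
    rcases k with _ | k
    · simp [esum_zero]
    rcases l with _ | l
    · simp [esum_zero]
    have h1 := ih (k + 1) (l + 1)
    have h2 := ih k (l + 1)
    have h3 := ih (k + 1) l
    rw [show k + 1 + (l + 1) = (k + l + 1) + 1 by ring] at h1 ⊢
    rw [show k + (l + 1) = k + l + 1 by ring] at h2
    rw [show k + 1 + l = k + l + 1 by ring] at h3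
    rw [esum_insert_succ ha, esum_insert_succ ha, esum_insert_succ ha]
    have h4 : ((k + l + 1 + 1).choose (k + 1) : R)
        = ((k + l + 1).choose k : R) + ((k + l + 1).choose (k + 1) : R) := by
      rw [Nat.choose_succ_succ]; push_cast; ring
    simp only [nsmul_eq_mul] at h1 h2 h3 ⊢
    rw [h4] at h1 ⊢
    linear_combination h1 + f a * h2 + f a * h3 + (esum s k f * esum s l f) * hf a

theorem coeff_prod_eq_esum [DecidableEq ι] (s : Finset ι) (f : ι → R) (k : ℕ) :
    (∏ i ∈ s, (1 + Polynomial.C (f i) * Polynomial.X)).coeff k = esum s k f := by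
  induction s using Finset.induction_on generalizing k with
  | empty =>
    rcases k with _ | k
    · simp [esum_zero]
    · rw [esum_empty_succ]; simp [Polynomial.coeff_one]
  | insert a s ha ih =>
    rw [Finset.prod_insert ha, add_mul, one_mul, Polynomial.coeff_add, mul_assoc,
      Polynomial.coeff_C_mul]
    rcases k with _ | k
    · simp [ih, esum_zero]
    · rw [Polynomial.coeff_X_mul, ih, ih, esum_insert_succ ha]

theorem esum_add [DecidableEq ι] (s : Finset ι) (f g : ι → R) (hfg : ∀ i, f i * g i = 0) (k : ℕ) :
    esum s k (fun i => f i + g i) =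
      ∑ p ∈ Finset.HasAntidiagonal.antidiagonal k, esum s p.1 f * esum s p.2 g := by
  simp only [← coeff_prod_eq_esum]
  rw [← Polynomial.coeff_mul, ← Finset.prod_mul_distrib]
  congr 1
  refine Finset.prod_congr rfl fun i _ => ?_
  have h : Polynomial.C (f i) * Polynomial.C (g i) = 0 := by
    rw [← Polynomial.C_mul, hfg, Polynomial.C_0]
  rw [Polynomial.C_add]
  linear_combination (-(Polynomial.X ^ 2)) * h

theorem esum_smul {A : Type*} [CommRing A] [Algebra A R] (s : Finset ι) (a : A) (f : ι → R)
    (k : ℕ) : esum s k (fun i => a • f i) = a ^ k • esum s k f := by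
  unfold esum
  rw [Finset.smul_sum]
  refine Finset.sum_congr rfl fun S hS => ?_
  rw [Finset.prod_smul, Finset.prod_const, (Finset.mem_powersetCard.1 hS).2]

end ESum

/-! ### Symmetric tensors -/

section Modules

variable (A : Type*) [CommRing A] (M : Type*) [AddCommGroup M] [Module A M]

/-- `TS^n_A(M)`: the tensors in the `n`-fold tensor power of `M` that are invariant under the action
`σ (m₁ ⊗ ⋯ ⊗ mₙ) = m_{σ⁻¹ 1} ⊗ ⋯ ⊗ m_{σ⁻¹ n}` of the symmetric group. -/
def symTensor (n : ℕ) : Submodule A (⨂[A]^n M) where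
  carrier := {t | ∀ σ : Equiv.Perm (Fin n), PiTensorProduct.reindex A (fun _ => M) σ t = t}
  add_mem' := fun {x y} hx hy σ => by
    change (PiTensorProduct.reindex A (fun _ => M) σ) (x + y) = x + y
    rw [map_add]; exact congrArg₂ _ (hx σ) (hy σ)
  zero_mem' := fun σ => (PiTensorProduct.reindex A (fun _ => M) σ).map_zero
  smul_mem' := fun c x hx σ => by
    change (PiTensorProduct.reindex A (fun _ => M) σ) (c • x) = c • x
    rw [map_smul]; exact congrArg _ (hx σ)

/-- `Γ^n_A(M)`: the degree `n` part of the divided power algebra `Γ_A(M)`, spanned by the products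
`γ^{ν₁}(x₁) × ⋯ × γ^{ν_r}(x_r)` with `ν₁ + ⋯ + ν_r = n`. -/
def divPow (n : ℕ) : Submodule A (DividedPowerAlgebra A M) :=
  Submodule.span A {p | ∃ l : Multiset (ℕ × M), (l.map Prod.fst).sum = n ∧
    p = (l.map fun q => DividedPowerAlgebra.dp A q.1 q.2).prod}

variable {A M} in
theorem dp_mem_divPow (n : ℕ) (x : M) : DividedPowerAlgebra.dp A n x ∈ divPow A M n :=
  Submodule.subset_span ⟨{(n, x)}, by simp, by simp⟩

/-- The element `γ^n(x)` of `Γ^n_A(M)`. -/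
def gammaPow (n : ℕ) (x : M) : divPow A M n :=
  ⟨DividedPowerAlgebra.dp A n x, dp_mem_divPow n x⟩

/-! ### Functoriality -/

variable {M} {N : Type*} [AddCommGroup N] [Module A N]

theorem map_mem_divPow (f : M →ₗ[A] N) (n : ℕ) :
    ∀ p ∈ divPow A M n, (DividedPowerAlgebra.map A f).toLinearMap p ∈ divPow A N n := by
  intro p hp
  induction hp using Submodule.span_induction with
  | mem p h =>
    obtain ⟨l, hl, rfl⟩ := h
    refine Submodule.subset_span ⟨l.map fun q => (q.1, f q.2), by simpa using hl, ?_⟩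
    simp [map_multiset_prod, Multiset.map_map]
  | zero => rw [map_zero]; exact Submodule.zero_mem _
  | add x y _ _ hx hy => rw [map_add]; exact Submodule.add_mem _ hx hy
  | smul a x _ hx => rw [map_smul]; exact Submodule.smul_mem _ _ hx

/-- `Γ^n_A(f) : Γ^n_A(M) → Γ^n_A(N)`, sending `γ^n(x)` to `γ^n(f x)`. -/
def divPowMap (f : M →ₗ[A] N) (n : ℕ) : divPow A M n →ₗ[A] divPow A N n :=
  (DividedPowerAlgebra.map A f).toLinearMap.restrict (map_mem_divPow A f n)

/-- `T^n_A(f) : T^n_A(M) → T^n_A(N)`. -/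
def tensorMap (f : M →ₗ[A] N) (n : ℕ) : (⨂[A]^n M) →ₗ[A] (⨂[A]^n N) :=
  PiTensorProduct.map fun _ => f

/-! ### The canonical map

The `n`-fold tensor power of the trivial square-zero extension `A ⊕ M` is a commutative ring that
contains `M^{⊗ n}` as the summand of multidegree `(1, …, 1)`.  The `k`-th elementary symmetric
sum of the copies of `x` in the `n` tensor factors satisfies the relations of the divided powers
`γ^k(x)`, and projecting a product of such sums to `M^{⊗ n}` gives the shuffle product of the
corresponding pure powers. -/

variable (M)

/-- The trivial square-zero extension `A ⊕ M`. -/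
def SqZero : Type _ := TrivSqZeroExt A M

/-- The right action of a commutative ring on a module, which agrees with the left action. -/
abbrev opModule : Module Aᵐᵒᵖ M := Module.compHom _ ((RingHom.id A).fromOpposite mul_comm)

theorem opModule_central : @IsCentralScalar A M _ (opModule A M).toSMul :=
  letI := opModule A M
  ⟨fun _ _ => rfl⟩

instance : CommRing (SqZero A M) :=
  @TrivSqZeroExt.commRing A M _ _ _ (opModule A M) (opModule_central A M)

instance : Algebra A (SqZero A M) :=
  letI := opModule A M
  haveI := opModule_central A M
  TrivSqZeroExt.algebra' A A M

/-- The inclusion `M → A ⊕ M`. -/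
def SqZero.inr : M →ₗ[A] SqZero A M :=
  { toFun := fun m => (TrivSqZeroExt.inr m : TrivSqZeroExt A M)
    map_add' := fun x y => TrivSqZeroExt.inr_add A x y
    map_smul' := fun a x => TrivSqZeroExt.inr_smul A a x }

/-- The projection `A ⊕ M → M`. -/
def SqZero.snd : SqZero A M →ₗ[A] M :=
  { toFun := fun x => TrivSqZeroExt.snd (R := A) (M := M) x
    map_add' := fun x y => TrivSqZeroExt.snd_add (R := A) (M := M) x y
    map_smul' := fun a x => TrivSqZeroExt.snd_smul (R := A) (M := M) a x }

variable {M}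

theorem SqZero.inr_mul_inr (x y : M) : SqZero.inr A M x * SqZero.inr A M y = 0 :=
  letI := opModule A M
  TrivSqZeroExt.inr_mul_inr A x y

theorem SqZero.snd_inr (x : M) : SqZero.snd A M (SqZero.inr A M x) = x := rfl

variable (n : ℕ)

/-- The copy of `x : M` in the `i`-th factor of `(A ⊕ M)^{⊗ n}`. -/
def place (i : Fin n) (x : M) : ⨂[A]^n (SqZero A M) :=
  PiTensorProduct.singleAlgHom (R := A) (A := fun _ : Fin n => SqZero A M) i (SqZero.inr A M x)

theorem place_mul_place (i : Fin n) (x y : M) : place A n i x * place A n i y = 0 := by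
  unfold place
  rw [← map_mul, SqZero.inr_mul_inr, map_zero]

theorem place_add (i : Fin n) (x y : M) :
    place A n i (x + y) = place A n i x + place A n i y := by
  unfold place; rw [map_add, map_add]

theorem place_smul (i : Fin n) (a : A) (x : M) :
    place A n i (a • x) = a • place A n i x := by
  unfold place; rw [map_smul, map_smul]

variable (M)

/-- The algebra homomorphism `Γ_A(M) → (A ⊕ M)^{⊗ n}` that sends `γ^k(x)` to the sum over all
`k`-element subsets `S` of the tensor factors of the pure tensors with `x` in the factors of `S`
and `1` in the others. -/
def toSqZeroPower : DividedPowerAlgebra A M →ₐ[A] ⨂[A]^n (SqZero A M) :=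
  DividedPowerAlgebra.lift' (f := fun q => esum Finset.univ q.1 fun i => place A n i q.2)
    (fun _ => esum_zero _ _)
    (fun k a x => by simp only [place_smul, esum_smul])
    (fun k l x => esum_mul _ _ (fun i => place_mul_place A n i x x) k l)
    (fun k x y => by
      simp only [place_add]
      exact esum_add _ _ _ (fun i => place_mul_place A n i x y) k)

/-- The projection of `(A ⊕ M)^{⊗ n}` to `M^{⊗ n}`. -/
def topPart : (⨂[A]^n (SqZero A M)) →ₗ[A] ⨂[A]^n M :=
  PiTensorProduct.map fun _ => SqZero.snd A M

variable {M}

section Reindex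

variable (C : Type*) [CommRing C] [Algebra A C]

theorem reindex_mul (σ : Equiv.Perm (Fin n)) (x y : ⨂[A]^n C) :
    PiTensorProduct.reindex A (fun _ => C) σ (x * y) =
      PiTensorProduct.reindex A (fun _ => C) σ x * PiTensorProduct.reindex A (fun _ => C) σ y := by
  induction x using PiTensorProduct.induction_on with
  | add a b ha hb => simp only [add_mul, map_add, ha, hb]
  | smul_tprod r f =>
    induction y using PiTensorProduct.induction_on with
    | add a b ha hb => simp only [mul_add, map_add, ha, hb]
    | smul_tprod r' g =>
      simp only [PiTensorProduct.smul_tprod_mul_smul_tprod, map_smul,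
        PiTensorProduct.reindex_tprod]
      rfl

theorem reindex_one (σ : Equiv.Perm (Fin n)) :
    PiTensorProduct.reindex A (fun _ => C) σ 1 = 1 := by
  rw [PiTensorProduct.one_def, PiTensorProduct.reindex_tprod]
  rfl

/-- The permutation action on `C^{⊗ n}`, as an algebra homomorphism. -/
def reindexHom (σ : Equiv.Perm (Fin n)) : (⨂[A]^n C) →ₐ[A] ⨂[A]^n C :=
  AlgHom.ofLinearMap (PiTensorProduct.reindex A (fun _ => C) σ).toLinearMap
    (reindex_one A n C σ) (reindex_mul A n C σ)

end Reindex

theorem place_eq_tprod (i : Fin n) (x : M) :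
    place A n i x =
      PiTensorProduct.tprod A (Function.update (fun _ => 1) i (SqZero.inr A M x)) := rfl

theorem reindexHom_place (σ : Equiv.Perm (Fin n)) (i : Fin n) (x : M) :
    reindexHom A n (SqZero A M) σ (place A n i x) = place A n (σ i) x := by
  rw [place_eq_tprod, place_eq_tprod]
  change PiTensorProduct.reindex A (fun _ => SqZero A M) σ _ = _
  rw [PiTensorProduct.reindex_tprod]
  congr 1
  funext j
  by_cases h : j = σ i
  · subst h; simp
  · have h' : σ.symm j ≠ i := fun hh => h (by rw [← hh, Equiv.apply_symm_apply])
    simp [Function.update_of_ne h, Function.update_of_ne h']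

theorem reindexHom_esum (σ : Equiv.Perm (Fin n)) (k : ℕ) (x : M) :
    reindexHom A n (SqZero A M) σ (esum Finset.univ k fun i => place A n i x) =
      esum Finset.univ k fun i => place A n i x := by
  unfold esum
  simp only [map_sum, map_prod, reindexHom_place]
  refine Finset.sum_bij' (fun S _ => S.map σ.toEmbedding) (fun S _ => S.map σ.symm.toEmbedding)
    ?_ ?_ ?_ ?_ ?_
  · intro S hS; simpa using hS
  · intro S hS; simpa using hS
  · intro S _; ext j; simp
  · intro S _; ext j; simp
  · intro S _; simp

theorem reindexHom_comp (σ : Equiv.Perm (Fin n)) :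
    (reindexHom A n (SqZero A M) σ).comp (toSqZeroPower A M n) = toSqZeroPower A M n := by
  refine DividedPowerAlgebra.algHom_ext fun k x => ?_
  simp only [AlgHom.comp_apply, toSqZeroPower, DividedPowerAlgebra.lift'_apply_dp]
  exact reindexHom_esum A n σ k x

theorem reindex_topPart (σ : Equiv.Perm (Fin n)) (t : ⨂[A]^n (SqZero A M)) :
    PiTensorProduct.reindex A (fun _ => M) σ (topPart A M n t) =
      topPart A M n (reindexHom A n (SqZero A M) σ t) := by
  change _ = topPart A M n (PiTensorProduct.reindex A (fun _ => SqZero A M) σ t)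
  induction t using PiTensorProduct.induction_on with
  | add a b ha hb => simp only [map_add, ha, hb]
  | smul_tprod r f =>
    simp only [map_smul, PiTensorProduct.reindex_tprod, topPart,
      PiTensorProduct.map_tprod]

theorem topPart_mem (p : DividedPowerAlgebra A M) :
    topPart A M n (toSqZeroPower A M n p) ∈ symTensor A M n := fun σ => by
  rw [reindex_topPart, ← AlgHom.comp_apply, reindexHom_comp]

variable (M)

/-- The canonical map `Γ^n_A(M) → TS^n_A(M)`, sending `γ^n(x)` to `x^{⊗ n}`. -/
def canonicalMap : divPow A M n →ₗ[A] symTensor A M n :=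
  ((topPart A M n).comp (toSqZeroPower A M n).toLinearMap).codRestrict (symTensor A M n)
    (topPart_mem A n) ∘ₗ (divPow A M n).subtype

variable {M}

theorem canonicalMap_apply (p : divPow A M n) :
    (canonicalMap A M n p : ⨂[A]^n M) = topPart A M n (toSqZeroPower A M n p) := rfl

theorem prod_place (x : Fin n → M) :
    ∏ i, place A n i (x i) = PiTensorProduct.tprod A fun i => SqZero.inr A M (x i) := by
  simp only [place_eq_tprod]
  rw [← PiTensorProduct.tprod_prod]
  congr 1
  funext j
  rw [Finset.prod_apply, Finset.prod_eq_single j]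
  · simp
  · intro i _ hi; rw [Function.update_of_ne hi.symm]
  · simp

/-- The canonical map sends `γ^n(x)` to `x^{⊗ n}`. -/
theorem canonicalMap_gammaPow (x : M) :
    (canonicalMap A M n (gammaPow A M n x) : ⨂[A]^n M) = PiTensorProduct.tprod A fun _ => x := by
  rw [canonicalMap_apply]
  simp only [gammaPow, toSqZeroPower, DividedPowerAlgebra.lift'_apply_dp]
  have h : (Finset.univ : Finset (Fin n)).powersetCard n = {Finset.univ} := by
    simpa using Finset.powersetCard_self (Finset.univ : Finset (Fin n))
  rw [esum, h, Finset.sum_singleton, prod_place]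
  simp only [topPart, PiTensorProduct.map_tprod, SqZero.snd_inr]

variable {A} in
theorem prod_dp_cases (l : Multiset (ℕ × M)) :
    ((l.map Prod.fst).sum = 0 → (l.map fun q => DividedPowerAlgebra.dp A q.1 q.2).prod = 1) ∧
    ((l.map Prod.fst).sum = 1 → ∃ x, (l.map fun q => DividedPowerAlgebra.dp A q.1 q.2).prod =
      DividedPowerAlgebra.dp A 1 x) ∧
    ((l.map Prod.fst).sum = 2 →
      (∃ x, (l.map fun q => DividedPowerAlgebra.dp A q.1 q.2).prod =
        DividedPowerAlgebra.dp A 2 x) ∨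
      ∃ x y, (l.map fun q => DividedPowerAlgebra.dp A q.1 q.2).prod =
        DividedPowerAlgebra.dp A 1 x * DividedPowerAlgebra.dp A 1 y) := by
  induction l using Multiset.induction_on with
  | empty => simp
  | cons q l ih =>
    obtain ⟨d, x⟩ := q
    obtain ⟨h0, h1, h2⟩ := ih
    simp only [Multiset.map_cons, Multiset.sum_cons, Multiset.prod_cons]
    refine ⟨fun h => ?_, fun h => ?_, fun h => ?_⟩
    · obtain ⟨rfl, hl⟩ : d = 0 ∧ (l.map Prod.fst).sum = 0 := by omega
      rw [h0 hl, DividedPowerAlgebra.dp_zero, mul_one]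
    · obtain ⟨rfl, hl⟩ | ⟨rfl, hl⟩ : (d = 0 ∧ (l.map Prod.fst).sum = 1) ∨
          (d = 1 ∧ (l.map Prod.fst).sum = 0) := by omega
      · obtain ⟨y, hy⟩ := h1 hl
        exact ⟨y, by rw [hy, DividedPowerAlgebra.dp_zero, one_mul]⟩
      · exact ⟨x, by rw [h0 hl, mul_one]⟩
    · obtain ⟨rfl, hl⟩ | ⟨rfl, hl⟩ | ⟨rfl, hl⟩ : (d = 0 ∧ (l.map Prod.fst).sum = 2) ∨
          (d = 1 ∧ (l.map Prod.fst).sum = 1) ∨ (d = 2 ∧ (l.map Prod.fst).sum = 0) := by omega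
      · rw [DividedPowerAlgebra.dp_zero, one_mul]
        exact h2 hl
      · obtain ⟨y, hy⟩ := h1 hl
        exact Or.inr ⟨x, y, by rw [hy]⟩
      · exact Or.inl ⟨x, by rw [h0 hl, mul_one]⟩

/-- In degree `2` the canonical map is the only linear map that sends `γ^2(x)` to `x ⊗ x`. -/
theorem canonicalMap_two_unique (φ : divPow A M 2 →ₗ[A] symTensor A M 2)
    (hφ : ∀ x, (φ (gammaPow A M 2 x) : ⨂[A]^2 M) = PiTensorProduct.tprod A fun _ => x) :
    φ = canonicalMap A M 2 := by
  have hdp : ∀ x, φ (gammaPow A M 2 x) = canonicalMap A M 2 (gammaPow A M 2 x) := fun x =>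
    Subtype.ext (by rw [hφ, canonicalMap_gammaPow])
  ext1 ⟨p, hp⟩
  induction hp using Submodule.span_induction with
  | mem p h =>
    obtain ⟨l, hl, rfl⟩ := h
    obtain ⟨x, hx⟩ | ⟨x, y, hxy⟩ := (prod_dp_cases (A := A) l).2.2 hl
    · have : (⟨_, Submodule.subset_span ⟨l, hl, rfl⟩⟩ : divPow A M 2) = gammaPow A M 2 x :=
        Subtype.ext hx
      rw [this, hdp]
    · set w : divPow A M 2 := ⟨_, Submodule.subset_span ⟨l, hl, rfl⟩⟩ with hw
      have key : gammaPow A M 2 (x + y) = w + (gammaPow A M 2 x + gammaPow A M 2 y) := by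
        refine Subtype.ext ?_
        change DividedPowerAlgebra.dp A 2 (x + y) = (l.map fun q =>
          DividedPowerAlgebra.dp A q.1 q.2).prod +
            (DividedPowerAlgebra.dp A 2 x + DividedPowerAlgebra.dp A 2 y)
        rw [hxy, DividedPowerAlgebra.dp_add]
        simp [Finset.Nat.antidiagonal_succ, DividedPowerAlgebra.dp_zero]
        ring
      have h := hdp (x + y)
      rw [key, map_add, map_add, map_add, map_add, hdp, hdp] at h
      exact add_right_cancel h
  | zero => exact (map_zero φ).trans (map_zero (canonicalMap A M 2)).symm
  | add x y hx hy h1 h2 =>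
    have : (⟨x + y, Submodule.add_mem _ hx hy⟩ : divPow A M 2) = ⟨x, hx⟩ + ⟨y, hy⟩ := rfl
    rw [this, map_add, map_add, h1, h2]
  | smul a x hx h =>
    have : (⟨a • x, Submodule.smul_mem _ a hx⟩ : divPow A M 2) = a • ⟨x, hx⟩ := rfl
    rw [this, map_smul, map_smul, h]

/-! ### The two kernels attached to a map `F → M` -/

variable {N : Type*} [AddCommGroup N] [Module A N]

/-- The kernel of `Γ^n_A(F) → Γ^n_A(M)`, carried to a submodule of `TS^n_A(F)`, and so of
`T^n_A(F)`, by the canonical map `Γ^n_A(F) → TS^n_A(F)`. -/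
def divKernel (f : M →ₗ[A] N) : Submodule A (⨂[A]^n M) :=
  (LinearMap.ker (divPowMap A f n)).map ((symTensor A M n).subtype ∘ₗ canonicalMap A M n)

/-- The `S_n`-invariants of the kernel of `T^n_A(F) → T^n_A(M)`. -/
def invKernel (f : M →ₗ[A] N) : Submodule A (⨂[A]^n M) :=
  LinearMap.ker (tensorMap A f n) ⊓ symTensor A M n

end Modules

/-! ### The modules of the example

They are written over any commutative ring `A` with two elements `s` and `t`, and their base
changes over any commutative `A`-algebra `A'` with an element `z`. -/

section Example

variable (A : Type*) [CommRing A] (s t : A)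

/-- The standard basis `e₁, e₂` of `F = A²`, indexed by `0` and `1`. -/
def e (i : Fin 2) : Fin 2 → A := Pi.single i 1

/-- `M = A² / ⟨s e₁ + t e₂⟩`. -/
abbrev ModM : Type _ := (Fin 2 → A) ⧸ Submodule.span A {s • e A 0 + t • e A 1}

variable (A' : Type*) [CommRing A'] [Algebra A A'] (z : A')

/-- `F' = A' ⊗_A F`. -/
abbrev ModF' : Type _ := A' ⊗[A] (Fin 2 → A)

/-- The basis `1 ⊗ e₁, 1 ⊗ e₂` of `F'`. -/
def e' (i : Fin 2) : ModF' A A' := 1 ⊗ₜ[A] e A i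

/-- `M' = A' ⊗_A M`. -/
abbrev ModM' : Type _ := A' ⊗[A] ModM A s t

/-- The base change `F' → M'` of the quotient map `F → M`. -/
def proj' : ModF' A A' →ₗ[A'] ModM' A s t A' :=
  (Submodule.mkQ (Submodule.span A {s • e A 0 + t • e A 1})).baseChange A'

/-- The element `z s (e₁ ⊗ e₁ + e₂ ⊗ e₂)` of `T^2_{A'}(F')`. -/
def v' : ⨂[A']^2 (ModF' A A') :=
  (z * algebraMap A A' s) •
    (PiTensorProduct.tprod A' ![e' A A' 0, e' A A' 0] +
      PiTensorProduct.tprod A' ![e' A A' 1, e' A A' 1])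

/-- `Γ^2_A(M) → TS^2_A(M)`. -/
def canM : divPow A (ModM A s t) 2 →ₗ[A] symTensor A (ModM A s t) 2 :=
  canonicalMap A (ModM A s t) 2

/-- `Γ^2_{A'}(M') → TS^2_{A'}(M')`. -/
def canM' : divPow A' (ModM' A s t A') 2 →ₗ[A'] symTensor A' (ModM' A s t A') 2 :=
  canonicalMap A' (ModM' A s t A') 2

/-- `Γ^2_{A'}(F') → TS^2_{A'}(F')`. -/
def canF' : divPow A' (ModF' A A') 2 →ₗ[A'] symTensor A' (ModF' A A') 2 :=
  canonicalMap A' (ModF' A A') 2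

/-- The kernel `K'` of `TS^2_{A'}(F') ≅ Γ^2_{A'}(F') → Γ^2_{A'}(M')`, inside `T^2_{A'}(F')`. -/
def K' : Submodule A' (⨂[A']^2 (ModF' A A')) :=
  divKernel A' 2 (proj' A s t A')

/-- The invariants `(N')^{S_2}` of the kernel `N'` of `T^2_{A'}(F') → T^2_{A'}(M')`. -/
def invN' : Submodule A' (⨂[A']^2 (ModF' A A')) :=
  invKernel A' 2 (proj' A s t A')

end Example

/-! ### The rings of the example -/

section Rings

variable (k : Type*) [Field k]

/-- `A = k[s, t]`, with `s` and `t` the variables with index `0` and `1`. -/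
abbrev RingA : Type _ := MvPolynomial (Fin 2) k

/-- `s` in `A`. -/
abbrev varS : RingA k := MvPolynomial.X 0

/-- `t` in `A`. -/
abbrev varT : RingA k := MvPolynomial.X 1

/-- The ideal of `A[z] = k[s, t, z]` generated by `z (s + t)`. -/
def idealA' : Ideal (Polynomial (RingA k)) :=
  Ideal.span {Polynomial.X * Polynomial.C (varS k + varT k)}

/-- `A' = k[s, t, z] / (z (s + t))`. -/
abbrev RingA' : Type _ := Polynomial (RingA k) ⧸ idealA' k

/-- The image of `z` in `A'`. -/
def varZ' : RingA' k := Ideal.Quotient.mk (idealA' k) Polynomial.X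

end Rings

end SymDiv

end

/-!
Write `f₁, f₂` for the images of `e₁, e₂`, so that `s f₁ + t f₂ = 0`. For a module spanned by
`f₁, f₂`, the module `Γ²` is spanned by `γ²(f₁)`, `f₁f₂`, `γ²(f₂)` (`exists_eq_of_spanning_pair`),
which the canonical map sends to `f₁ ⊗ f₁`, `f₁ ⊗ f₂ + f₂ ⊗ f₁`, `f₂ ⊗ f₂`. If `f₁, f₂` is a basis,
these images are a basis of the symmetric tensors, so the canonical map is bijective
(`canonicalMap_two_bijective`).

Over `A`, multiplying the relation by `f₁` and `f₂` gives `t f₁f₂ = s f₁f₂ = 0` in `Γ²(M)`, as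
`fᵢ fᵢ = 2 γ²(fᵢ) = 0`, and then `γ²(s f₁ + t f₂) = 0` gives `s² γ²(f₁) + t² γ²(f₂) = 0`. Let
`a γ²(f₁) + b f₁f₂ + c γ²(f₂)` be in the kernel of the canonical map. Pairing its image with the map
`M → A`, `f₁ ↦ t`, `f₂ ↦ -s`, in both factors gives `a t² + c s² = 0`, as `2 = 0`, so that
`a = s² m` and `c = t² m`. Pairing with the two coordinates `M → A / ⟨s, t⟩` gives `b ∈ ⟨s, t⟩`. So
the element vanishes (`canM_injective`).

Over `A'` we have `z s = z t`, as `2 = 0`, and therefore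
`z s (f₁ ⊗ f₁) = z s (f₂ ⊗ f₁) = z s (f₂ ⊗ f₂)` in `T²(M')`: the element `z s (γ²(f₁) + γ²(f₂))` is
in the kernel of the canonical map (`smul_tmulTwo_add_eq_zero`). It is not zero: with `A'` acting on
the dual numbers `k[σ] / (σ²)` by `s, t ↦ σ` and `z ↦ 1`, the square of the first coordinate modulo
`σ` is a well defined additive quadratic map on `M'`, so it factors through `γ²`, and the resulting
functional takes the value `σ` (`map_eq_zero_of_gammaPow_relation`, `gammaPow_relation_ne_zero`).
The inclusion of `K'` in the invariants of `N'` is the naturality of the canonical map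
(`tensorMap_canonicalMap`).
-/

open scoped TensorProduct

namespace SymDiv

/-! ### Degree two divided powers and tensors -/

section DegreeTwo

variable {R : Type*} [CommRing R] {M : Type*} [AddCommGroup M] [Module R M]
  {N : Type*} [AddCommGroup N] [Module R N]

variable (R M) in
/-- The product `γ¹(x) γ¹(y)` in `Γ²(M)`, as a bilinear map. -/
noncomputable def gammaMul : M →ₗ[R] M →ₗ[R] divPow R M 2 :=
  LinearMap.mk₂ R
    (fun x y => ⟨DividedPowerAlgebra.embed R M x * DividedPowerAlgebra.embed R M y,
      Submodule.subset_span ⟨{(1, x), (1, y)}, by simp, by simp [DividedPowerAlgebra.embed_def]⟩⟩)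
    (fun x x' y => Subtype.ext (by simp [add_mul]))
    (fun a x y => Subtype.ext (by simp))
    (fun x y y' => Subtype.ext (by simp [mul_add]))
    (fun a x y => Subtype.ext (by simp))

theorem gammaMul_coe (x y : M) : (gammaMul R M x y : DividedPowerAlgebra R M) =
    DividedPowerAlgebra.dp R 1 x * DividedPowerAlgebra.dp R 1 y := rfl

theorem gammaMul_self (x : M) : gammaMul R M x x = (2 : R) • gammaPow R M 2 x := by
  refine Subtype.ext ?_
  rw [gammaMul_coe, DividedPowerAlgebra.dp_mul, two_smul]
  simp [gammaPow, two_smul]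

theorem gammaPow_smul (a : R) (x : M) :
    gammaPow R M 2 (a • x) = a ^ 2 • gammaPow R M 2 x :=
  Subtype.ext DividedPowerAlgebra.dp_smul

theorem gammaPow_add (x y : M) : gammaPow R M 2 (x + y) =
    gammaPow R M 2 x + gammaMul R M x y + gammaPow R M 2 y := by
  refine Subtype.ext ?_
  change DividedPowerAlgebra.dp R 2 (x + y) = DividedPowerAlgebra.dp R 2 x +
    DividedPowerAlgebra.dp R 1 x * DividedPowerAlgebra.dp R 1 y + DividedPowerAlgebra.dp R 2 y
  rw [DividedPowerAlgebra.dp_add]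
  simp [Finset.Nat.antidiagonal_succ, DividedPowerAlgebra.dp_zero]
  ring

theorem gammaPow_zero : gammaPow R M 2 0 = 0 := by
  simpa using gammaPow_smul (0 : R) (0 : M)

/-- `Γ²(M)` is spanned by the squares `γ²(x)` alone, because `γ¹(x) γ¹(y)` is the polarisation
of `γ²`. -/
theorem span_range_gammaPow :
    Submodule.span R (Set.range (gammaPow R M 2)) = ⊤ := by
  rw [eq_top_iff]
  refine le_trans (Submodule.span_span_coe_preimage (R := R)).ge (Submodule.span_le.2 ?_)
  rintro ⟨p, hp⟩ ⟨l, hl, hpl⟩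
  have hpow : ∀ x, gammaPow R M 2 x ∈ Submodule.span R (Set.range (gammaPow R M 2)) :=
    fun x => Submodule.subset_span ⟨x, rfl⟩
  obtain ⟨x, hx⟩ | ⟨x, y, hxy⟩ := (prod_dp_cases (A := R) l).2.2 hl
  · have h : (⟨p, hp⟩ : divPow R M 2) = gammaPow R M 2 x := Subtype.ext (hpl.trans hx)
    exact (congrArg (· ∈ Submodule.span R (Set.range (gammaPow R M 2))) h).mpr (hpow x)
  · have h : (⟨p, hp⟩ : divPow R M 2) = gammaPow R M 2 (x + y) +
        ((-1 : R) • gammaPow R M 2 x + (-1 : R) • gammaPow R M 2 y) := by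
      have : (⟨p, hp⟩ : divPow R M 2) = gammaMul R M x y := Subtype.ext (hpl.trans hxy)
      rw [this, gammaPow_add]
      module
    refine (congrArg (· ∈ Submodule.span R (Set.range (gammaPow R M 2))) h).mpr ?_
    exact Submodule.add_mem _ (hpow _)
      (Submodule.add_mem _ (Submodule.smul_mem _ _ (hpow _)) (Submodule.smul_mem _ _ (hpow _)))

theorem exists_eq_of_spanning_pair {x y : M} (hxy : ∀ u : M, ∃ a b : R, u = a • x + b • y)
    (p : divPow R M 2) : ∃ a b c : R,
      p = a • gammaPow R M 2 x + b • gammaMul R M x y + c • gammaPow R M 2 y := by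
  have hp : p ∈ Submodule.span R (Set.range (gammaPow R M 2)) := by
    rw [span_range_gammaPow]; trivial
  induction hp using Submodule.span_induction with
  | mem p h =>
    obtain ⟨u, rfl⟩ := h
    obtain ⟨a, b, rfl⟩ := hxy u
    exact ⟨a ^ 2, a * b, b ^ 2, by
      simp [gammaPow_add, gammaPow_smul, smul_smul, mul_comm]⟩
  | zero => exact ⟨0, 0, 0, by simp⟩
  | add p q _ _ hp hq =>
    obtain ⟨a, b, c, rfl⟩ := hp
    obtain ⟨a', b', c', rfl⟩ := hq
    exact ⟨a + a', b + b', c + c', by module⟩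
  | smul r p _ hp =>
    obtain ⟨a, b, c, rfl⟩ := hp
    exact ⟨r * a, r * b, r * c, by module⟩

variable (R M) in
/-- The pure tensor `x ⊗ y` in `T²(M)`, as a bilinear map. -/
noncomputable def tmulTwo : M →ₗ[R] M →ₗ[R] ⨂[R]^2 M :=
  LinearMap.mk₂ R (fun x y => PiTensorProduct.tprod R (s := fun _ : Fin 2 => M) ![x, y])
    (fun x x' y => MultilinearMap.cons_add (M := fun _ : Fin 2 => M) (PiTensorProduct.tprod R)
      ![y] x x')
    (fun a x y => MultilinearMap.cons_smul (M := fun _ : Fin 2 => M)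
      (PiTensorProduct.tprod R) ![y] a x)
    (fun x y y' => by
      have h : ∀ w, ![x, w] = Function.update ![x, 0] 1 w := fun w => by
        funext i; fin_cases i <;> rfl
      rw [h, h y, h y', MultilinearMap.map_update_add])
    (fun a x y => by
      have h : ∀ w, ![x, w] = Function.update ![x, 0] 1 w := fun w => by
        funext i; fin_cases i <;> rfl
      rw [h, h y, MultilinearMap.map_update_smul])

theorem tmulTwo_apply (x y : M) :
    tmulTwo R M x y = PiTensorProduct.tprod R (s := fun _ : Fin 2 => M) ![x, y] := rfl

theorem tprod_eq_tmulTwo (f : Fin 2 → M) :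
    PiTensorProduct.tprod R f = tmulTwo R M (f 0) (f 1) := by
  rw [tmulTwo_apply]
  congr 1
  funext i; fin_cases i <;> rfl

theorem canonicalMap_gammaPow_two (x : M) :
    (canonicalMap R M 2 (gammaPow R M 2 x) : ⨂[R]^2 M) = tmulTwo R M x x := by
  rw [canonicalMap_gammaPow, tprod_eq_tmulTwo]

theorem canonicalMap_gammaMul (x y : M) :
    (canonicalMap R M 2 (gammaMul R M x y) : ⨂[R]^2 M) =
      tmulTwo R M x y + tmulTwo R M y x := by
  have h := canonicalMap_gammaPow_two (R := R) (x + y)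
  rw [gammaPow_add, map_add, map_add, Submodule.coe_add, Submodule.coe_add,
    canonicalMap_gammaPow_two, canonicalMap_gammaPow_two] at h
  simp only [map_add, LinearMap.add_apply] at h
  refine add_left_cancel (a := tmulTwo R M x x) (add_right_cancel (b := tmulTwo R M y y) ?_)
  exact h.trans (by abel)

theorem reindex_swap_tmulTwo (x y : M) :
    PiTensorProduct.reindex R (fun _ => M) (Equiv.swap (0 : Fin 2) 1) (tmulTwo R M x y) =
      tmulTwo R M y x := by
  rw [tmulTwo_apply, PiTensorProduct.reindex_tprod, tprod_eq_tmulTwo]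
  rfl

theorem tensorMap_tmulTwo (f : M →ₗ[R] N) (x y : M) :
    tensorMap R f 2 (tmulTwo R M x y) = tmulTwo R N (f x) (f y) := by
  rw [tmulTwo_apply, tensorMap, PiTensorProduct.map_tprod, tprod_eq_tmulTwo]
  rfl

theorem divPowMap_gammaPow (f : M →ₗ[R] N) (x : M) :
    divPowMap R f 2 (gammaPow R M 2 x) = gammaPow R N 2 (f x) :=
  Subtype.ext (by simp [divPowMap, gammaPow])

theorem tensorMap_canonicalMap (f : M →ₗ[R] N) (p : divPow R M 2) :
    tensorMap R f 2 (canonicalMap R M 2 p) = canonicalMap R N 2 (divPowMap R f 2 p) := by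
  have h : tensorMap R f 2 ∘ₗ (symTensor R M 2).subtype ∘ₗ canonicalMap R M 2 =
      (symTensor R N 2).subtype ∘ₗ canonicalMap R N 2 ∘ₗ divPowMap R f 2 := by
    refine LinearMap.ext_on_range span_range_gammaPow fun x => ?_
    simp [canonicalMap_gammaPow_two, tensorMap_tmulTwo, divPowMap_gammaPow]
  exact LinearMap.congr_fun h p

theorem divKernel_le_invKernel (f : M →ₗ[R] N) : divKernel R 2 f ≤ invKernel R 2 f := by
  rintro _ ⟨p, hp, rfl⟩
  refine ⟨?_, (canonicalMap R M 2 p).2⟩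
  refine LinearMap.mem_ker.2 ?_
  refine (tensorMap_canonicalMap f p).trans ?_
  rw [LinearMap.mem_ker.1 hp, map_zero, Submodule.coe_zero]

/-- The linear map `T²(M) → C` sending `x ⊗ y` to `φ(x) ψ(y)`. -/
noncomputable def pairing {C : Type*} [CommRing C] [Algebra R C] (φ ψ : M →ₗ[R] C) :
    (⨂[R]^2 M) →ₗ[R] C :=
  PiTensorProduct.lift ((MultilinearMap.mkPiAlgebra R (Fin 2) C).compLinearMap ![φ, ψ])

@[simp]
theorem pairing_tmulTwo {C : Type*} [CommRing C] [Algebra R C] (φ ψ : M →ₗ[R] C) (x y : M) :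
    pairing φ ψ (tmulTwo R M x y) = φ x * ψ y := by
  rw [tmulTwo_apply, pairing, PiTensorProduct.lift.tprod]
  simp

/-- For a module with a basis of two elements, both `Γ²` and `TS²` are free of rank three, on
`γ²(e₁), e₁e₂, γ²(e₂)` and their images. -/
theorem canonicalMap_two_bijective (b : Module.Basis (Fin 2) R M) :
    Function.Bijective (canonicalMap R M 2) := by
  have hb : ∀ u : M, ∃ a c : R, u = a • b 0 + c • b 1 := fun u =>
    ⟨b.repr u 0, b.repr u 1, by rw [← Fin.sum_univ_two fun i => b.repr u i • b i, b.sum_repr]⟩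
  have hcoord : ∀ i j, b.coord i (b j) = if j = i then 1 else 0 := fun i j => by
    rw [Module.Basis.coord_apply, Module.Basis.repr_self, Finsupp.single_apply]
  constructor
  · rw [injective_iff_map_eq_zero]
    intro p hp
    obtain ⟨a, d, c, rfl⟩ := exists_eq_of_spanning_pair hb p
    have h := congrArg (Subtype.val) hp
    simp only [map_add, map_smul, Submodule.coe_add, Submodule.coe_smul, Submodule.coe_zero,
      canonicalMap_gammaPow_two, canonicalMap_gammaMul] at h
    have h00 := congrArg (pairing (b.coord 0) (b.coord 0)) h
    have h01 := congrArg (pairing (b.coord 0) (b.coord 1)) h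
    have h11 := congrArg (pairing (b.coord 1) (b.coord 1)) h
    simp only [map_add, map_smul, pairing_tmulTwo, hcoord, map_zero] at h00 h01 h11
    simp at h00 h01 h11
    simp [h00, h01, h11]
  · rintro ⟨x, hx⟩
    have key : ∃ a c d g : R, x = a • tmulTwo R M (b 0) (b 0) + c • tmulTwo R M (b 0) (b 1) +
        d • tmulTwo R M (b 1) (b 0) + g • tmulTwo R M (b 1) (b 1) := by
      clear hx
      induction x using PiTensorProduct.induction_on with
      | add x y hx hy =>
        obtain ⟨a, c, d, g, rfl⟩ := hx
        obtain ⟨a', c', d', g', rfl⟩ := hy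
        exact ⟨a + a', c + c', d + d', g + g', by module⟩
      | smul_tprod r f =>
        rw [tprod_eq_tmulTwo]
        obtain ⟨a, c, h0⟩ := hb (f 0)
        obtain ⟨d, g, h1⟩ := hb (f 1)
        refine ⟨r * (a * d), r * (a * g), r * (c * d), r * (c * g), ?_⟩
        rw [h0, h1]
        simp only [map_add, map_smul, LinearMap.add_apply, LinearMap.smul_apply]
        module
    obtain ⟨a, c, d, g, rfl⟩ := key
    have h := congrArg (pairing (b.coord 1) (b.coord 0)) (hx (Equiv.swap 0 1))
    simp only [map_add, map_smul, reindex_swap_tmulTwo, pairing_tmulTwo, hcoord] at h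
    simp at h
    subst h
    refine ⟨a • gammaPow R M 2 (b 0) + c • gammaMul R M (b 0) (b 1) + g • gammaPow R M 2 (b 1),
      Subtype.ext ?_⟩
    simp only [map_add, map_smul, Submodule.coe_add, Submodule.coe_smul,
      canonicalMap_gammaPow_two, canonicalMap_gammaMul]
    module

/-- A function `q` with `q(a x) = a² q(x)` whose polar form vanishes is a quadratic map, and
factors through `γ²` when its target has exponent `2`. -/
theorem exists_linearMap_gammaPow_two (q : M → N) (hq_add : ∀ x y, q (x + y) = q x + q y)
    (hq_smul : ∀ (a : R) x, q (a • x) = a ^ 2 • q x) (h2 : ∀ y : N, (2 : ℕ) • y = 0) :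
    ∃ φ : divPow R M 2 →ₗ[R] N, ∀ x, φ (gammaPow R M 2 x) = q x := by
  -- In `R ⊕ N` the divided powers of `x` are `1, 0, q(x), 0, 0, …`.
  let f : ℕ × M → SqZero R N := fun u =>
    if u.1 = 0 then 1 else if u.1 = 2 then SqZero.inr R N (q u.2) else 0
  have f0 : ∀ x, f (0, x) = 1 := fun x => by simp [f]
  have f1 : ∀ x, f (1, x) = 0 := fun x => by simp [f]
  have f2 : ∀ x, f (2, x) = SqZero.inr R N (q x) := fun x => by simp [f]
  have f3 : ∀ n x, f (n + 3, x) = 0 := fun n x => by simp [f]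
  have hmul : ∀ m n x y, 3 ≤ m + n → 0 < m → 0 < n → f (m, x) * f (n, y) = 0 := by
    intro m n x y _ hm hn
    match m, n with
    | 1, n => rw [f1, zero_mul]
    | m + 3, n => rw [f3, zero_mul]
    | m, 1 => rw [f1, mul_zero]
    | m, n + 3 => rw [f3, mul_zero]
    | 2, 2 => rw [f2, f2, SqZero.inr_mul_inr]
  have hbig : ∀ n x, 3 ≤ n → f (n, x) = 0 := fun n x hn => by
    obtain ⟨m, rfl⟩ := Nat.exists_eq_add_of_le' hn
    exact f3 m x
  let Φ : DividedPowerAlgebra R M →ₐ[R] SqZero R N := DividedPowerAlgebra.lift' (f := f) f0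
    (fun n a x => by
      match n with
      | 0 => rw [f0, f0, pow_zero, one_smul]
      | 1 => rw [f1, f1, smul_zero]
      | 2 => rw [f2, f2, hq_smul, map_smul]
      | n + 3 => rw [f3, f3, smul_zero])
    (fun m n x => by
      rcases Nat.eq_zero_or_pos m with rfl | hm
      · rw [f0, one_mul, zero_add, Nat.choose_zero_right, one_smul]
      rcases Nat.eq_zero_or_pos n with rfl | hn
      · rw [f0, mul_one, add_zero, Nat.choose_self, one_smul]
      by_cases h : 3 ≤ m + n
      · rw [hmul _ _ _ _ h hm hn, hbig _ _ h, smul_zero]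
      · obtain ⟨rfl, rfl⟩ : m = 1 ∧ n = 1 := by omega
        change f (1, x) * f (1, x) = (2 : ℕ) • f (2, x)
        rw [f1, f2, ← map_nsmul, h2, map_zero, zero_mul])
    (fun n x y => by
      match n with
      | 0 => simp [f0]
      | 1 => simp [Finset.Nat.antidiagonal_succ, f1]
      | 2 => simp [Finset.Nat.antidiagonal_succ, f0, f1, f2, hq_add, add_comm]
      | n + 3 =>
        rw [f3, Finset.sum_eq_zero]
        rintro ⟨i, j⟩ hij
        replace hij : i + j = n + 3 := Finset.HasAntidiagonal.mem_antidiagonal.1 hij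
        dsimp only
        rcases Nat.eq_zero_or_pos i with rfl | hi
        · rw [hbig j _ (by omega), mul_zero]
        rcases Nat.eq_zero_or_pos j with rfl | hj
        · rw [hbig i _ (by omega), zero_mul]
        exact hmul _ _ _ _ (by omega) hi hj)
  refine ⟨SqZero.snd R N ∘ₗ Φ.toLinearMap ∘ₗ (divPow R M 2).subtype, fun x => ?_⟩
  change SqZero.snd R N (Φ (DividedPowerAlgebra.dp R 2 x)) = q x
  rw [DividedPowerAlgebra.lift'_apply_dp, f2, SqZero.snd_inr]

end DegreeTwo

/-! ### The module with one relation -/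

section OneRelation

variable {A : Type*} [CommRing A] (s t : A)

/-- The image of the basis vector `e i` in `A² / ⟨s e₁ + t e₂⟩`. -/
def gen (i : Fin 2) : ModM A s t := Submodule.Quotient.mk (e A i)

theorem gen_relation : s • gen s t 0 + t • gen s t 1 = 0 :=
  (Submodule.Quotient.mk_eq_zero _).2 (Submodule.mem_span_singleton_self _)

theorem exists_eq_gen (u : ModM A s t) : ∃ a b : A, u = a • gen s t 0 + b • gen s t 1 := by
  obtain ⟨x, rfl⟩ := Submodule.Quotient.mk_surjective _ u
  refine ⟨x 0, x 1, congrArg (Submodule.Quotient.mk (p := Submodule.span A _)) ?_⟩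
  funext i
  fin_cases i <;> simp [e]

variable {s t} in
/-- The linear map on `A² / ⟨s e₁ + t e₂⟩` that sends `e₁` to `x` and `e₂` to `y`. -/
noncomputable def liftPair {P : Type*} [AddCommGroup P] [Module A P] (x y : P)
    (h : s • x + t • y = 0) : ModM A s t →ₗ[A] P :=
  Submodule.liftQ _ (Fintype.linearCombination A ![x, y]) (by
    rw [Submodule.span_singleton_le_iff_mem, LinearMap.mem_ker]
    simpa [e, Fintype.linearCombination_apply] using h)

variable {s t} in
@[simp]
theorem liftPair_gen_zero {P : Type*} [AddCommGroup P] [Module A P] (x y : P)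
    (h : s • x + t • y = 0) : liftPair x y h (gen s t 0) = x :=
  (Submodule.liftQ_apply _ _ _).trans (by simp [e, Fintype.linearCombination_apply])

variable {s t} in
@[simp]
theorem liftPair_gen_one {P : Type*} [AddCommGroup P] [Module A P] (x y : P)
    (h : s • x + t • y = 0) : liftPair x y h (gen s t 1) = y :=
  (Submodule.liftQ_apply _ _ _).trans (by simp [e, Fintype.linearCombination_apply])

/-- Over a ring of characteristic `2` in which every relation `a t² = c s²` is a multiple of the
trivial one (as when `s², t²` is a regular sequence), `Γ²(M) → TS²(M)` is injective for
`M = A² / ⟨s e₁ + t e₂⟩`: the maps from `M` to `A` and to `A / ⟨s, t⟩` show that a kernel element is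
a multiple of `s² γ²(e₁) + t² γ²(e₂)` plus a multiple of `e₁e₂` by an element of `⟨s, t⟩`, and such
elements vanish already in `Γ²(M)`. -/
theorem canM_injective (h2 : (2 : A) = 0)
    (hst : ∀ a c : A, a * t ^ 2 = c * s ^ 2 → ∃ m, a = s ^ 2 * m ∧ c = t ^ 2 * m) :
    Function.Injective (canM A s t) := by
  rw [injective_iff_map_eq_zero]
  intro p hp
  obtain ⟨a, b, c, rfl⟩ := exists_eq_of_spanning_pair (exists_eq_gen s t) p
  have h := congrArg Subtype.val hp
  simp only [canM, map_add, map_smul, Submodule.coe_add, Submodule.coe_smul, Submodule.coe_zero,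
    canonicalMap_gammaPow_two, canonicalMap_gammaMul] at h
  obtain ⟨m, rfl, rfl⟩ : ∃ m, a = s ^ 2 * m ∧ c = t ^ 2 * m := by
    have hφ := congrArg (pairing (liftPair (s := s) (t := t) t (-s) (by simp; ring))
      (liftPair (s := s) (t := t) t (-s) (by simp; ring))) h
    simp only [map_add, map_smul, pairing_tmulTwo, liftPair_gen_zero, liftPair_gen_one,
      map_zero, smul_eq_mul] at hφ
    exact hst a c (by linear_combination hφ + (b * s * t - c * s ^ 2) * h2)
  have hs : Ideal.Quotient.mk (Ideal.span {s, t}) s = 0 :=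
    Ideal.Quotient.eq_zero_iff_mem.2 (Ideal.subset_span (by simp))
  have ht : Ideal.Quotient.mk (Ideal.span {s, t}) t = 0 :=
    Ideal.Quotient.eq_zero_iff_mem.2 (Ideal.subset_span (by simp))
  obtain ⟨u, v, rfl⟩ : ∃ u v, u * s + v * t = b := by
    have hψ := congrArg (pairing
      (liftPair (s := s) (t := t) (1 : A ⧸ Ideal.span {s, t}) 0
        (by simp [Algebra.smul_def, hs]))
      (liftPair (s := s) (t := t) (0 : A ⧸ Ideal.span {s, t}) 1
        (by simp [Algebra.smul_def, ht]))) h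
    simp only [map_add, map_smul, pairing_tmulTwo, liftPair_gen_zero, liftPair_gen_one,
      map_zero] at hψ
    simp [Algebra.smul_def] at hψ
    exact Ideal.mem_span_pair.1 (Ideal.Quotient.eq_zero_iff_mem.1 hψ)
  have hrel := gen_relation s t
  generalize gen s t = f at hrel ⊢
  have hs0 : s • gammaMul A _ (f 0) (f 1) = 0 := by
    have h0 := congrArg (fun x => gammaMul A _ x (f 1)) hrel
    simpa only [map_add, map_smul, LinearMap.add_apply, LinearMap.smul_apply, gammaMul_self, h2,
      zero_smul, smul_zero, add_zero, zero_add, map_zero, LinearMap.zero_apply] using h0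
  have ht0 : t • gammaMul A _ (f 0) (f 1) = 0 := by
    have h0 := congrArg (fun x => gammaMul A _ (f 0) x) hrel
    simpa only [map_add, map_smul, LinearMap.add_apply, LinearMap.smul_apply, gammaMul_self, h2,
      zero_smul, smul_zero, add_zero, zero_add, map_zero, LinearMap.zero_apply] using h0
  have hw : s ^ 2 • gammaPow A _ 2 (f 0) + t ^ 2 • gammaPow A _ 2 (f 1) = 0 := by
    have h0 := gammaPow_add (R := A) (s • f 0) (t • f 1)
    rw [hrel, gammaPow_zero, gammaPow_smul, gammaPow_smul, map_smul, map_smul,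
      LinearMap.smul_apply, hs0, smul_zero, add_zero] at h0
    exact h0.symm
  calc _ = m • (s ^ 2 • gammaPow A _ 2 (f 0) + t ^ 2 • gammaPow A _ 2 (f 1)) +
        (u • s • gammaMul A _ (f 0) (f 1) + v • t • gammaMul A _ (f 0) (f 1)) := by module
    _ = 0 := by rw [hw, hs0, ht0, smul_zero, smul_zero, smul_zero, add_zero, add_zero]

end OneRelation

/-! ### Base change of the module with one relation -/

section BaseChange

variable {A : Type*} [CommRing A] (s t : A) (A' : Type*) [CommRing A'] [Algebra A A']

theorem proj'_e' (i : Fin 2) : proj' A s t A' (e' A A' i) = 1 ⊗ₜ[A] gen s t i := rfl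

theorem proj'_relation :
    algebraMap A A' s • proj' A s t A' (e' A A' 0) +
      algebraMap A A' t • proj' A s t A' (e' A A' 1) = 0 := by
  rw [proj'_e', proj'_e', algebraMap_smul, algebraMap_smul, ← TensorProduct.tmul_smul,
    ← TensorProduct.tmul_smul, ← TensorProduct.tmul_add, gen_relation, TensorProduct.tmul_zero]

/-- The basis `e' 0, e' 1` of `F'`. -/
noncomputable def basisF' : Module.Basis (Fin 2) A' (ModF' A A') :=
  (Pi.basisFun A (Fin 2)).baseChange A'

/-- A functional on `Γ²(M')`. In characteristic `2` the square of the first coordinate is additive,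
and it is well defined on `M'` if the coordinate is taken in an `A'`-algebra `K` in which `s`
vanishes, while the square is taken in a ring `D` in which the square of an element of `A'` depends
only on its image in `K`. This is a quadratic map on `M'` with zero polar form, so it gives a linear
map on `Γ²(M')` that sends `γ²(e₁)` to `1` and `γ²(e₂)` to `0`. -/
theorem map_eq_zero_of_gammaPow_relation {K D : Type*} [CommRing K] [CommRing D]
    (hD : (2 : D) = 0) (θ : A' →+* K) (ι : K →+* D) (ψ : A' →+* D)
    (hψ : ∀ a, ψ a ^ 2 = ι (θ a) ^ 2) (hs : θ (algebraMap A A' s) = 0) {a c : A'}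
    (h : a • gammaPow A' _ 2 (proj' A s t A' (e' A A' 0)) +
      c • gammaPow A' _ 2 (proj' A s t A' (e' A A' 1)) = 0) : ψ a = 0 := by
  let _ : Module A' D := Module.compHom D ψ
  let _ : Module A' K := Module.compHom K θ
  let _ : Module A K := Module.compHom K (θ.comp (algebraMap A A'))
  have _ : IsScalarTower A A' K := ⟨fun x y w => by
    change θ (x • y) * w = θ (algebraMap A A' x) * (θ y * w)
    rw [Algebra.smul_def, map_mul, mul_assoc]⟩
  let l : ModM' A s t A' →ₗ[A'] K := (liftPair (s := s) (t := t) (1 : K) 0 (by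
    rw [smul_zero, add_zero]
    change θ (algebraMap A A' s) * 1 = 0
    rw [hs, zero_mul])).liftBaseChange A'
  have l0 : l (proj' A s t A' (e' A A' 0)) = 1 := by
    rw [proj'_e', LinearMap.liftBaseChange_tmul, one_smul, liftPair_gen_zero]
  have l1 : l (proj' A s t A' (e' A A' 1)) = 0 := by
    rw [proj'_e', LinearMap.liftBaseChange_tmul, one_smul, liftPair_gen_one]
  obtain ⟨φ, hφ⟩ := exists_linearMap_gammaPow_two (R := A') (fun x => ι (l x) ^ 2)
    (fun x y => by
      rw [map_add, map_add]
      linear_combination (ι (l x) * ι (l y)) * hD)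
    (fun b x => by
      change _ = ψ (b ^ 2) * _
      rw [map_smul, map_pow, hψ, ← mul_pow, ← map_mul]
      rfl)
    (fun y => by rw [nsmul_eq_mul, Nat.cast_ofNat, hD, zero_mul])
  have h' := congrArg φ h
  rw [map_add, map_smul, map_smul, hφ, hφ, l0, l1, LinearMap.map_zero] at h'
  change ψ a * _ + ψ c * _ = 0 at h'
  simpa using h'

variable {A'} in
/-- If `z s = z t` and `2 = 0`, then both `z s (e₁ ⊗ e₁)` and `z s (e₂ ⊗ e₂)` become equal to
`z s (e₂ ⊗ e₁)` once `s e₁ + t e₂ = 0`. -/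
theorem smul_tmulTwo_add_eq_zero {M : Type*} [AddCommGroup M] [Module A' M] (h2 : (2 : A') = 0)
    {a b z : A'} (hz : z * (a + b) = 0) {x y : M} (hxy : a • x + b • y = 0) :
    (z * a) • (tmulTwo A' M x x + tmulTwo A' M y y) = 0 := by
  have hx := congrArg (fun w => z • tmulTwo A' M w x) hxy
  have hy := congrArg (fun w => z • tmulTwo A' M y w) hxy
  simp only [map_add, map_smul, LinearMap.add_apply, LinearMap.smul_apply, smul_add, smul_smul,
    map_zero, LinearMap.zero_apply, smul_zero] at hx hy
  have hb : z * b = z * a := by linear_combination hz - z * a * h2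
  rw [hb] at hx hy
  have hyx : (z * a) • tmulTwo A' M y x + (z * a) • tmulTwo A' M y x = 0 := by
    rw [← two_smul A', h2, zero_smul]
  rw [smul_add]
  calc _ = ((z * a) • tmulTwo A' M x x + (z * a) • tmulTwo A' M y x) +
        ((z * a) • tmulTwo A' M y x + (z * a) • tmulTwo A' M y y) := by
          rw [add_assoc, ← add_assoc (_ • tmulTwo A' M y x), hyx, zero_add]
    _ = 0 := by rw [hx, hy, add_zero]

variable {s t A'} in
/-- If `z (s + t) = 0` and `2 = 0`, the element `z s (γ²(e₁) + γ²(e₂))` of `Γ²(M')` is in the kernel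
of the canonical map, and as soon as it is nonzero the canonical map is not injective and the kernel
`K'` misses an invariant of `N'`. -/
theorem canM'_not_injective_and_v'_mem (h2 : (2 : A') = 0) {z : A'}
    (hz : z * (algebraMap A A' s + algebraMap A A' t) = 0)
    (hne : (z * algebraMap A A' s) • gammaPow A' _ 2 (proj' A s t A' (e' A A' 0)) +
      (z * algebraMap A A' s) • gammaPow A' _ 2 (proj' A s t A' (e' A A' 1)) ≠ 0) :
    ¬ Function.Injective (canM' A s t A') ∧ v' A s A' z ∈ invN' A s t A' ∧
      v' A s A' z ∉ K' A s t A' := by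
  set a := z * algebraMap A A' s with ha
  let p : divPow A' (ModF' A A') 2 :=
    a • gammaPow A' _ 2 (e' A A' 0) + a • gammaPow A' _ 2 (e' A A' 1)
  have hp : (canonicalMap A' _ 2 p : ⨂[A']^2 (ModF' A A')) = v' A s A' z := by
    rw [map_add, map_smul, map_smul, Submodule.coe_add, Submodule.coe_smul, Submodule.coe_smul,
      canonicalMap_gammaPow_two, canonicalMap_gammaPow_two, ← smul_add]
    rfl
  have hpp : divPowMap A' (proj' A s t A') 2 p =
      a • gammaPow A' _ 2 (proj' A s t A' (e' A A' 0)) +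
        a • gammaPow A' _ 2 (proj' A s t A' (e' A A' 1)) := by
    rw [map_add, map_smul, map_smul, divPowMap_gammaPow, divPowMap_gammaPow]
  rw [← hpp] at hne
  have hzero : canonicalMap A' _ 2 (divPowMap A' (proj' A s t A') 2 p) = 0 := by
    refine Subtype.ext ?_
    rw [hpp, map_add, map_smul, map_smul, Submodule.coe_add, Submodule.coe_smul,
      Submodule.coe_smul, canonicalMap_gammaPow_two, canonicalMap_gammaPow_two, ← smul_add]
    exact smul_tmulTwo_add_eq_zero h2 hz (proj'_relation s t A')
  refine ⟨fun hinj => hne (hinj (hzero.trans (map_zero _).symm)), ?_, ?_⟩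
  · rw [← hp]
    refine ⟨LinearMap.mem_ker.2 ?_, (canonicalMap A' _ 2 p).2⟩
    exact (tensorMap_canonicalMap _ p).trans (congrArg Subtype.val hzero)
  · rintro ⟨p', hp', hv⟩
    have hinj := (canonicalMap_two_bijective (basisF' (A := A) A')).1
    have hpp' : p' = p := hinj (Subtype.ext (hv.trans hp.symm))
    exact hne (hpp' ▸ LinearMap.mem_ker.1 hp')

end BaseChange

/-! ### The example -/

section Rings

variable (k : Type*) [Field k]

/-- The ring homomorphism from `A' = k[s, t, z] / (z (s + t))` to a `k`-algebra that sends
`s, t, z` to `x, y, w`. -/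
noncomputable def evalA' {C : Type*} [CommRing C] [Algebra k C] (x y w : C)
    (h : w * (x + y) = 0) : RingA' k →+* C :=
  Ideal.Quotient.lift (idealA' k)
    (Polynomial.eval₂RingHom (MvPolynomial.aeval ![x, y] : RingA k →ₐ[k] C).toRingHom w)
    fun a ha => by
      obtain ⟨b, rfl⟩ := Ideal.mem_span_singleton'.1 ha
      simp [h]

/-- The structure map `A → A'`. -/
noncomputable abbrev toA' : RingA k →+* RingA' k := algebraMap (RingA k) (RingA' k)

variable {C : Type*} [CommRing C] [Algebra k C] (x y w : C) (h : w * (x + y) = 0)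

theorem evalA'_toA' (p : RingA k) :
    evalA' k x y w h (toA' k p) = MvPolynomial.aeval ![x, y] p :=
  Polynomial.eval₂_C _ _

theorem evalA'_varZ' : evalA' k x y w h (varZ' k) = w := Polynomial.eval₂_X _ _

theorem varZ'_mul_add : varZ' k *
    (toA' k (varS k) + toA' k (varT k)) = 0 := by
  rw [← map_add]
  exact Ideal.Quotient.eq_zero_iff_mem.2 (Ideal.mem_span_singleton_self _)

theorem exists_mul_sq_of_mul_sq_eq (a c : RingA k) (h : a * varT k ^ 2 = c * varS k ^ 2) :
    ∃ m, a = varS k ^ 2 * m ∧ c = varT k ^ 2 * m := by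
  have hS : Prime (varS k) := MvPolynomial.X_prime
  have hST : ¬ varS k ∣ varT k ^ 2 := fun hd => by
    simpa using MvPolynomial.X_dvd_X.1 (hS.dvd_of_dvd_pow hd)
  obtain ⟨m, rfl⟩ := hS.pow_dvd_of_dvd_mul_right 2 hST ⟨c, h.trans (mul_comm _ _)⟩
  refine ⟨m, rfl, mul_right_cancel₀ (pow_ne_zero 2 hS.ne_zero) (h.symm.trans (by ring))⟩

theorem gammaPow_relation_ne_zero [CharP k 2] (c : RingA' k) :
    (varZ' k * toA' k (varS k)) •
        gammaPow (RingA' k) _ 2 (proj' (RingA k) (varS k) (varT k) (RingA' k) (e' _ _ 0)) +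
      c • gammaPow (RingA' k) _ 2 (proj' (RingA k) (varS k) (varT k) (RingA' k) (e' _ _ 1)) ≠
        0 := by
  intro h
  have hk : (2 : k) = 0 := CharTwo.two_eq_zero
  have hD : (2 : DualNumber k) = 0 := by
    rw [← map_ofNat (TrivSqZeroExt.inlHom k k) 2, hk, map_zero]
  -- `s` and `t` go to `σ` and `z` goes to `1`: this respects `z (s + t) = 0` as `2 σ = 0`.
  have hσ : (1 : DualNumber k) * (DualNumber.eps + DualNumber.eps) = 0 := by
    rw [← two_mul, hD, zero_mul, mul_zero]
  have h0 := map_eq_zero_of_gammaPow_relation (varS k) (varT k) (RingA' k) hD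
    (((TrivSqZeroExt.fstHom k k k : DualNumber k →ₐ[k] k) : DualNumber k →+* k).comp
      (evalA' k DualNumber.eps DualNumber.eps 1 hσ))
    (TrivSqZeroExt.inlHom k k) (evalA' k DualNumber.eps DualNumber.eps 1 hσ)
    (fun a => by
      generalize hx : evalA' k DualNumber.eps DualNumber.eps 1 hσ a = x
      rw [RingHom.comp_apply, hx]
      ext
      · simp
      · simp [pow_two, mul_comm, ← two_mul, hk])
    (by rw [RingHom.comp_apply, evalA'_toA']; simp) h
  rw [map_mul, evalA'_varZ', evalA'_toA'] at h0
  simpa using congrArg TrivSqZeroExt.snd h0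

end Rings

end SymDiv

theorem mainTheorem1 (k : Type*) [Field k] [CharP k 2] :
    Function.Injective (SymDiv.canM (SymDiv.RingA k) (SymDiv.varS k) (SymDiv.varT k)) ∧
    ¬ Function.Injective
      (SymDiv.canM' (SymDiv.RingA k) (SymDiv.varS k) (SymDiv.varT k) (SymDiv.RingA' k)) ∧
    Function.Bijective (SymDiv.canF' (SymDiv.RingA k) (SymDiv.RingA' k)) ∧
    SymDiv.K' (SymDiv.RingA k) (SymDiv.varS k) (SymDiv.varT k) (SymDiv.RingA' k) ≤
      SymDiv.invN' (SymDiv.RingA k) (SymDiv.varS k) (SymDiv.varT k) (SymDiv.RingA' k) ∧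
    SymDiv.v' (SymDiv.RingA k) (SymDiv.varS k) (SymDiv.RingA' k) (SymDiv.varZ' k) ∈
      SymDiv.invN' (SymDiv.RingA k) (SymDiv.varS k) (SymDiv.varT k) (SymDiv.RingA' k) ∧
    SymDiv.v' (SymDiv.RingA k) (SymDiv.varS k) (SymDiv.RingA' k) (SymDiv.varZ' k) ∉
      SymDiv.K' (SymDiv.RingA k) (SymDiv.varS k) (SymDiv.varT k) (SymDiv.RingA' k) := by
  have hA : (2 : SymDiv.RingA k) = 0 := CharTwo.two_eq_zero
  have hA' : (2 : SymDiv.RingA' k) = 0 := by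
    rw [← map_ofNat (SymDiv.toA' k) 2, hA, map_zero]
  obtain ⟨hinj, hmem, hnot⟩ := SymDiv.canM'_not_injective_and_v'_mem hA' (SymDiv.varZ'_mul_add k)
    (SymDiv.gammaPow_relation_ne_zero k _)
  exact ⟨SymDiv.canM_injective _ _ hA (SymDiv.exists_mul_sq_of_mul_sq_eq k), hinj,
    SymDiv.canonicalMap_two_bijective (SymDiv.basisF' _), SymDiv.divKernel_le_invKernel _,
    hmem, hnot⟩
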